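/- (Strong maximum principle.) Let $n\ge 1$ and $0<\beta<1$. Write $z=(z_1,\dots,z_n)$ for the coordinates of $\mathbb{C}^n$, let $D=\{z_1=0\}\subset\mathbb{C}^n$, and let $$\omega_\beta=\beta^2|z_1|^{2\beta-2}\,\tfrac{\sqrt{-1}}{2}\,dz_1\wedge d\bar z_1+\tfrac{\sqrt{-1}}{2}\sum_{j=2}^n dz_j\wedge d\bar z_j$$ be the standard cone metric. Let $\Omega\subset\mathbb{C}^n$ be a bounded connected open set with $\Omega\cap D\neq\emptyset$, and let $\omega=\tfrac{\sqrt{-1}}{2}\sum_{j,k} g_{j\bar k}\,dz_j\wedge d\bar z_k$ be a weak conical Kähler metric on $\Omega$, that is, a smooth Kähler metric on $\Omega\setminus D$ such that $C^{-1}\omega_\beta\le\omega\le C\omega_\beta$ on $\Omega\setminus D$ for some constant $C>0$. Let $u\in C^2(\Omega\setminus D)$ be a bounded real-valued function with $$\Delta_\omega u=\sum_{j,k} g^{j\bar k}\frac{\partial^2 u}{\partial z_j\,\partial\bar z_k}\ \ge\ 0\qquad\text{on }\Omega\setminus D,$$ where $(g^{j\bar k})$ is the inverse of $(g_{j\bar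 k})$, so that $\sum_{k} g^{j\bar k}g_{l\bar k}=\delta_{jl}$. No continuity of $u$ across $D$ is assumed. Suppose that there is a nonempty connected open set $\Omega'$ with compact closure $\overline{\Omega'}\subset\Omega$ such that $$\sup_{\Omega\setminus D}u=\sup_{\Omega'\setminus D}u .$$ Then $u$ is constant on $\Omega\setminus D$. -/

import Mathlib

open scoped ContDiff ComplexOrder

noncomputable section

namespace Conical

/-- The standing divisor `D = {z | z₀ = 0}` in `ℂⁿ`, `n ≥ 1`; the coordinate transverse to `D`
is the one with index `0`. -/
def divisor (n : ℕ) [NeZero n] : Set (EuclideanSpace ℂ (Fin n)) :=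
  {z | z 0 = 0}

/-- The Wirtinger derivative `∂f/∂z_j = (1/2) (∂f/∂x_j - i ∂f/∂y_j)`, where `z_j = x_j + i y_j`. -/
def dz {n : ℕ} (j : Fin n) (f : EuclideanSpace ℂ (Fin n) → ℂ) (z : EuclideanSpace ℂ (Fin n)) : ℂ :=
  (1 / 2 : ℂ) * (fderiv ℝ f z (EuclideanSpace.single j 1)
    - Complex.I * fderiv ℝ f z (EuclideanSpace.single j Complex.I))

/-- The Wirtinger derivative `∂f/∂z̄_j = (1/2) (∂f/∂x_j + i ∂f/∂y_j)`. -/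
def dzbar {n : ℕ} (j : Fin n) (f : EuclideanSpace ℂ (Fin n) → ℂ)
    (z : EuclideanSpace ℂ (Fin n)) : ℂ :=
  (1 / 2 : ℂ) * (fderiv ℝ f z (EuclideanSpace.single j 1)
    + Complex.I * fderiv ℝ f z (EuclideanSpace.single j Complex.I))

/-- The complex Hessian `(∂²u/∂z_j ∂z̄_k)_{j,k}` of a real function, the coefficient matrix
of `∂∂̄u`. -/
def complexHessian {n : ℕ} (u : EuclideanSpace ℂ (Fin n) → ℝ) (z : EuclideanSpace ℂ (Fin n)) :
    Matrix (Fin n) (Fin n) ℂ :=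
  Matrix.of fun j k => dz j (fun w => dzbar k (fun v => (u v : ℂ)) w) z

/-- The coefficient matrix `(g_{j k̄})` of the standard cone form of cone angle `2πβ` along `D`,
`ω_β = (i/2) (β² |z₀|^(2β-2) dz₀ ∧ dz̄₀ + ∑_{j ≠ 0} dz_j ∧ dz̄_j)`. -/
def modelCone {n : ℕ} [NeZero n] (β : ℝ) (z : EuclideanSpace ℂ (Fin n)) :
    Matrix (Fin n) (Fin n) ℂ :=
  Matrix.diagonal fun j => if j = 0 then ((β ^ 2 * ‖z 0‖ ^ (2 * β - 2) : ℝ) : ℂ) else 1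

/-- The real `(1,1)`-form `ω = (i/2) ∑ g_{j k̄} dz_j ∧ dz̄_k` is a smooth Kähler metric on the
open set `U ⊆ ℂⁿ`. Since `g` is Hermitian, `dω = 0` is equivalent to `∂ω = 0`, that is, to
the symmetry `∂g_{j k̄}/∂z_i = ∂g_{i k̄}/∂z_j`. -/
structure IsKahlerMetricOn {n : ℕ}
    (g : EuclideanSpace ℂ (Fin n) → Matrix (Fin n) (Fin n) ℂ)
    (U : Set (EuclideanSpace ℂ (Fin n))) : Prop where
  smooth : ∀ j k, ContDiffOn ℝ ∞ (fun z => g z j k) U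
  posDef : ∀ z ∈ U, (g z).PosDef
  closed : ∀ z ∈ U, ∀ i j k, dz i (fun w => g w j k) z = dz j (fun w => g w i k) z

/-- `ω = (i/2) ∑ g_{j k̄} dz_j ∧ dz̄_k` is a weak conical Kähler metric on `Ω` of cone angle `2πβ`
along `D`: a smooth Kähler metric on `Ω \ D` with `C⁻¹ ω_β ≤ ω ≤ C ω_β` there for some
constant `C > 0`. -/
structure IsWeakConicalMetric {n : ℕ} [NeZero n] (β : ℝ)
    (g : EuclideanSpace ℂ (Fin n) → Matrix (Fin n) (Fin n) ℂ)
    (Ω : Set (EuclideanSpace ℂ (Fin n))) : Prop where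
  kahler : IsKahlerMetricOn g (Ω \ divisor n)
  quasiIsometric : ∃ C : ℝ, 0 < C ∧ ∀ z ∈ Ω \ divisor n,
    (g z - C⁻¹ • modelCone β z).PosSemidef ∧ (C • modelCone β z - g z).PosSemidef

/-- The Laplacian `Δ_ω u = ∑_{j,k} g^{k̄ j} ∂²u/∂z_j ∂z̄_k` of the Kähler metric
`ω = (i/2) ∑ g_{j k̄} dz_j ∧ dz̄_k`, where `(g^{k̄ j})` is the inverse matrix of `(g_{j k̄})`. The sum
is a real number; it is a quarter of the Laplace-Beltrami operator of the Riemannian metric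
`Re ∑ g_{j k̄} dz_j ⊗ dz̄_k`. -/
def laplacian {n : ℕ} (g : EuclideanSpace ℂ (Fin n) → Matrix (Fin n) (Fin n) ℂ)
    (u : EuclideanSpace ℂ (Fin n) → ℝ) (z : EuclideanSpace ℂ (Fin n)) : ℝ :=
  (Matrix.trace ((g z)⁻¹ * complexHessian u z)).re

end Conical

end

/-! Let `c` be the supremum of `u`. Every `p ∈ Ω` satisfies a dichotomy: off the divisor, either `u
= c` near `p`, or `u ≤ c - δ` near `p` for some `δ > 0`. Both alternatives are open conditions on
`p`, and they exclude each other because `D` has empty interior. If the second held throughout the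
compact set `closure Ω'`, finitely many neighbourhoods would give `sup u ≤ c - δ` on `Ω' \ D`,
contradicting `hsup`. Hence the first holds somewhere, and by connectedness of `Ω` everywhere.

Off `D` the dichotomy is continuity together with the classical strong maximum principle
(`eventually_eq_of_max`), proved by touching the maximum set with a ball. At `p ∈ D` take a small
ball `B`. Since `B \ D` is connected, a maximum attained there makes `u = c` on all of it
(`eq_of_max`). Otherwise `u < c` on `B \ D`, and `eventually_le_sub_of_lt` makes the gap uniform
near `p` with the barrier `a B |z₀|^(2β) + ε log |z₀| - a |z - p|²`. The Laplacian of `|z₀|^(2β)` is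
bounded below by a positive constant and that of `|z - p|²` is bounded above, by quasi-isometry with
the model cone. The logarithm is pluriharmonic off `D` and tends to `-∞` there, so no information on
`u` at `D` is needed; finally `ε → 0`. -/

namespace Matrix

/-! ### Positive matrices. -/

open scoped MatrixOrder Matrix.Norms.L2Operator in
/-- The trace of a product of two positive semidefinite matrices is nonnegative. -/
theorem PosSemidef.re_trace_mul_nonneg {n : Type*} [Fintype n] [DecidableEq n]
    {A B : Matrix n n ℂ} (hA : A.PosSemidef) (hB : B.PosSemidef) : 0 ≤ (trace (A * B)).re := by
  obtain ⟨P, rfl⟩ : ∃ P : Matrix n n ℂ, A = Pᴴ * P := by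
    obtain ⟨P, hP⟩ := CStarAlgebra.nonneg_iff_eq_star_mul_self.1 (nonneg_iff_posSemidef.2 hA)
    exact ⟨P, hP⟩
  rw [Matrix.mul_assoc, trace_mul_comm]
  have := (hB.mul_mul_conjTranspose_same P).trace_nonneg
  exact (Complex.le_def.1 this).1

/-- Cauchy-Schwarz for a positive definite matrix and its inverse on a coordinate vector. -/
theorem PosDef.one_le_re_mul_inv_diag {n : Type*} [Fintype n] [DecidableEq n]
    {A : Matrix n n ℂ} (hA : A.PosDef) (i : n) : 1 ≤ (A i i).re * (A⁻¹ i i).re := by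
  have hu : IsUnit A.det := (Matrix.isUnit_iff_isUnit_det A).1 hA.isUnit
  have hb : 0 < (A i i).re := (Complex.lt_def.1 hA.diag_pos).1
  set b := (A i i).re with hbdef
  have hAi : A i i = (b : ℂ) := by
    refine Complex.ext (by simp [hbdef]) ?_
    simpa using (Complex.lt_def.1 (hA.diag_pos (i := i))).2.symm
  have hD : (A⁻¹ - Matrix.single i i ((b⁻¹ : ℝ) : ℂ)).IsHermitian := by
    refine hA.inv.isHermitian.sub ?_
    rw [Matrix.IsHermitian]
    rw [Matrix.conjTranspose_single]
    simp
  -- With `X = A⁻¹ - b⁻¹ Eᵢᵢ`, the `(i, i)` entry of `Xᴴ A X ≥ 0` is exactly `(A⁻¹)ᵢᵢ - b⁻¹`.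
  have h := (hA.posSemidef.conjTranspose_mul_mul_same
    (A⁻¹ - Matrix.single i i ((b⁻¹ : ℝ) : ℂ))).diag_nonneg (i := i)
  have hs : (Matrix.single i i ((b⁻¹ : ℝ) : ℂ) * A * A⁻¹) i i = ((b⁻¹ : ℝ) : ℂ) := by
    rw [Matrix.mul_assoc, Matrix.mul_nonsing_inv _ hu, Matrix.mul_one]; simp
  have hs2 : (Matrix.single i i ((b⁻¹ : ℝ) : ℂ) * A * Matrix.single i i ((b⁻¹ : ℝ) : ℂ)) i i
      = ((b⁻¹ : ℝ) : ℂ) := by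
    have hb' : (b : ℂ) ≠ 0 := by exact_mod_cast hb.ne'
    rw [Matrix.single_mul_mul_single, hAi]
    simp [hb']
  have he : (A⁻¹ - Matrix.single i i ((b⁻¹ : ℝ) : ℂ)) * A
      * (A⁻¹ - Matrix.single i i ((b⁻¹ : ℝ) : ℂ))
      = A⁻¹ - Matrix.single i i ((b⁻¹ : ℝ) : ℂ) - (Matrix.single i i ((b⁻¹ : ℝ) : ℂ) * A * A⁻¹
        - Matrix.single i i ((b⁻¹ : ℝ) : ℂ) * A * Matrix.single i i ((b⁻¹ : ℝ) : ℂ)) := by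
    rw [sub_mul, Matrix.nonsing_inv_mul _ hu, sub_mul, one_mul, mul_sub]
  rw [hD.eq, he] at h
  simp only [Matrix.sub_apply, hs, hs2, Matrix.single_apply_same] at h
  have h2 := (Complex.le_def.1 h).1
  simp only [Complex.sub_re, Complex.ofReal_re, Complex.zero_re] at h2
  have : b⁻¹ ≤ (A⁻¹ i i).re := by linarith
  calc (1 : ℝ) = b * b⁻¹ := (mul_inv_cancel₀ hb.ne').symm
    _ ≤ _ := by gcongr

end Matrix

noncomputable section

namespace Conical

/-! ### The Levi form, the Laplacian and the second-order condition at a maximum. -/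

variable {n : ℕ}

local notation "E" => EuclideanSpace ℂ (Fin n)

/-- The `(1,1)`-part of a real bilinear form, as a sesquilinear form: linear in the first
variable, conjugate-linear in the second. -/
def leviForm (D : EuclideanSpace ℂ (Fin n) →L[ℝ] EuclideanSpace ℂ (Fin n) →L[ℝ] ℝ)
    (v w : EuclideanSpace ℂ (Fin n)) : ℂ :=
  (1 / 4 : ℂ) * (D v w + D (Complex.I • v) (Complex.I • w)
    + Complex.I * (D v (Complex.I • w) - D (Complex.I • v) w))

/-- The matrix of the Levi form in the standard basis. -/
def leviMatrix (D : EuclideanSpace ℂ (Fin n) →L[ℝ] EuclideanSpace ℂ (Fin n) →L[ℝ] ℝ) :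
    Matrix (Fin n) (Fin n) ℂ :=
  Matrix.of fun j k => leviForm D (EuclideanSpace.single j 1) (EuclideanSpace.single k 1)

theorem leviMatrix_add (D D' : E →L[ℝ] E →L[ℝ] ℝ) :
    leviMatrix (D + D') = leviMatrix D + leviMatrix D' := by
  ext j k
  simp [leviMatrix, leviForm]
  ring

theorem leviMatrix_smul (t : ℝ) (D : E →L[ℝ] E →L[ℝ] ℝ) :
    leviMatrix (t • D) = (t : ℂ) • leviMatrix D := by
  ext j k
  simp [leviMatrix, leviForm]
  ring

/-- This replaces iterated Wirtinger derivatives by the real second derivative, so that all later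
computations take place on a real bilinear form. -/
theorem complexHessian_eq_leviMatrix {u : E → ℝ} {z : E} (hu : ContDiffAt ℝ 2 u z) :
    complexHessian u z = leviMatrix (fderiv ℝ (fderiv ℝ u) z) := by
  have hd : ∀ᶠ w in nhds z, DifferentiableAt ℝ u w :=
    (hu.eventually (by simp)).mono fun w hw => hw.differentiableAt (by simp)
  have hD : DifferentiableAt ℝ (fderiv ℝ u) z :=
    (hu.fderiv_right (m := 1) (by norm_num)).differentiableAt (by simp)
  have hI : ∀ j : Fin n, EuclideanSpace.single j Complex.I
      = Complex.I • (EuclideanSpace.single j 1 : E) := by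
    intro j; ext i; simp
  ext j k
  have hk : (fun w => dzbar k (fun v => (u v : ℂ)) w) =ᶠ[nhds z] fun w =>
      (1 / 2 : ℂ) * ((fderiv ℝ u w (EuclideanSpace.single k 1) : ℂ)
        + Complex.I * (fderiv ℝ u w (EuclideanSpace.single k Complex.I) : ℂ)) := by
    filter_upwards [hd] with w hw
    have : HasFDerivAt (fun v => (u v : ℂ)) (Complex.ofRealCLM.comp (fderiv ℝ u w)) w :=
      Complex.ofRealCLM.hasFDerivAt.comp w hw.hasFDerivAt
    simp [dzbar, this.fderiv]
  have h1 : ∀ v : E, HasFDerivAt (fun w => (fderiv ℝ u w v : ℂ))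
      (Complex.ofRealCLM.comp ((fderiv ℝ (fderiv ℝ u) z).flip v)) z := fun v =>
    Complex.ofRealCLM.hasFDerivAt.comp z (hD.hasFDerivAt.clm_apply (hasFDerivAt_const v z) |>.congr_fderiv (by ext; simp))
  have h2 := ((h1 (EuclideanSpace.single k 1)).add
    ((h1 (EuclideanSpace.single k Complex.I)).const_mul Complex.I)).const_mul (1 / 2 : ℂ)
  simp only [complexHessian, Matrix.of_apply, dz]
  rw [hk.fderiv_eq, HasFDerivAt.fderiv (f := fun w : E => (1 / 2 : ℂ) *
    ((fderiv ℝ u w (EuclideanSpace.single k 1) : ℂ)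
      + Complex.I * (fderiv ℝ u w (EuclideanSpace.single k Complex.I) : ℂ))) h2]
  simp only [leviMatrix, leviForm, Matrix.of_apply, hI]
  simp
  linear_combination (-(fderiv ℝ (fderiv ℝ u) z (Complex.I • EuclideanSpace.single j 1)
    (Complex.I • EuclideanSpace.single k 1) : ℂ) / 4) * Complex.I_sq

theorem laplacian_eq {g : E → Matrix (Fin n) (Fin n) ℂ} {u : E → ℝ} {z : E}
    {D : E →L[ℝ] E →L[ℝ] ℝ} (hu : ContDiffAt ℝ 2 u z) (hD : HasFDerivAt (fderiv ℝ u) D z) :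
    laplacian g u z = (Matrix.trace ((g z)⁻¹ * leviMatrix D)).re := by
  rw [laplacian, complexHessian_eq_leviMatrix hu, hD.fderiv]

theorem laplacian_add {g : E → Matrix (Fin n) (Fin n) ℂ} {u v : E → ℝ} {z : E}
    (hu : ContDiffAt ℝ 2 u z) (hv : ContDiffAt ℝ 2 v z) :
    laplacian g (fun w => u w + v w) z = laplacian g u z + laplacian g v z := by
  have hd : ∀ {f : E → ℝ}, ContDiffAt ℝ 2 f z → ∀ᶠ w in nhds z, DifferentiableAt ℝ f w :=
    fun hf => (hf.eventually (by simp)).mono fun w hw => hw.differentiableAt (by simp)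
  have hD : ∀ {f : E → ℝ}, ContDiffAt ℝ 2 f z → DifferentiableAt ℝ (fderiv ℝ f) z :=
    fun hf => (hf.fderiv_right (m := 1) (by norm_num)).differentiableAt (by simp)
  have h : fderiv ℝ (fun w => u w + v w) =ᶠ[nhds z] fun w => fderiv ℝ u w + fderiv ℝ v w := by
    filter_upwards [hd hu, hd hv] with w h1 h2 using fderiv_fun_add h1 h2
  rw [laplacian_eq (hu.add hv)
    (((hD hu).hasFDerivAt.add (hD hv).hasFDerivAt).congr_of_eventuallyEq h),
    laplacian_eq hu (hD hu).hasFDerivAt, laplacian_eq hv (hD hv).hasFDerivAt, leviMatrix_add,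
    Matrix.mul_add, Matrix.trace_add, Complex.add_re]

theorem laplacian_const_mul {g : E → Matrix (Fin n) (Fin n) ℂ} {u : E → ℝ} {z : E} (t : ℝ)
    (hu : ContDiffAt ℝ 2 u z) :
    laplacian g (fun w => t * u w) z = t * laplacian g u z := by
  have hd : ∀ᶠ w in nhds z, DifferentiableAt ℝ u w :=
    (hu.eventually (by simp)).mono fun w hw => hw.differentiableAt (by simp)
  have hD : DifferentiableAt ℝ (fderiv ℝ u) z :=
    (hu.fderiv_right (m := 1) (by norm_num)).differentiableAt (by simp)
  have h : fderiv ℝ (fun w => t * u w) =ᶠ[nhds z] fun w => t • fderiv ℝ u w := by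
    filter_upwards [hd] with w h1 using fderiv_const_mul h1 t
  rw [laplacian_eq (contDiffAt_const.mul hu)
    ((hD.hasFDerivAt.const_smul t).congr_of_eventuallyEq h),
    laplacian_eq hu hD.hasFDerivAt, leviMatrix_smul, Matrix.mul_smul, Matrix.trace_smul,
    smul_eq_mul, Complex.re_ofReal_mul]

/-- Second-order necessary condition at a local maximum. -/
theorem snd_fderiv_nonpos_of_isLocalMax {F : Type*} [NormedAddCommGroup F] [NormedSpace ℝ F]
    {u : F → ℝ} {z : F} (hu : ContDiffAt ℝ 2 u z) (hm : IsLocalMax u z) (v : F) :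
    fderiv ℝ (fderiv ℝ u) z v v ≤ 0 := by
  by_contra! hpos
  have hd : ∀ᶠ w in nhds z, DifferentiableAt ℝ u w :=
    (hu.eventually (by simp)).mono fun w hw => hw.differentiableAt (by simp)
  have hD : DifferentiableAt ℝ (fderiv ℝ u) z :=
    (hu.fderiv_right (m := 1) (by norm_num)).differentiableAt (by simp)
  set γ : ℝ → F := fun t => z + t • v with hγ
  have hγ0 : γ 0 = z := by simp [hγ]
  have hγd : ∀ t, HasDerivAt γ v t := fun t => by
    simpa [hγ] using ((hasDerivAt_id t).smul_const v).const_add z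
  have hγc : Filter.Tendsto γ (nhds 0) (nhds z) := hγ0 ▸ (hγd 0).continuousAt
  have hf : deriv (fun t => u (γ t)) =ᶠ[nhds 0] fun t => fderiv ℝ u (γ t) v := by
    filter_upwards [hγc.eventually hd] with t ht
    exact (ht.hasFDerivAt.comp_hasDerivAt t (hγd t)).deriv
  have hf2 : HasDerivAt (fun t => fderiv ℝ u (γ t) v) (fderiv ℝ (fderiv ℝ u) z v v) 0 := by
    have h1 : HasFDerivAt (fderiv ℝ u) (fderiv ℝ (fderiv ℝ u) z) (γ 0) := hγ0 ▸ hD.hasFDerivAt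
    simpa using (h1.comp_hasDerivAt 0 (hγd 0)).clm_apply (hasDerivAt_const 0 v)
  have hdd : deriv (deriv fun t => u (γ t)) 0 = fderiv ℝ (fderiv ℝ u) z v v := by
    rw [hf.deriv_eq, hf2.deriv]
  have hmax : IsLocalMax (fun t => u (γ t)) 0 := by
    filter_upwards [hγc.eventually hm] with t ht
    simpa [hγ0] using ht
  -- A positive second derivative would make the critical point a local minimum as well, so `u`
  -- would be constant along the line near it, with zero second derivative.
  have hmin : IsLocalMin (fun t => u (γ t)) 0 := by
    refine isLocalMin_of_deriv_deriv_pos (hdd ▸ hpos) hmax.deriv_eq_zero ?_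
    exact ContinuousAt.comp (by rw [hγ0]; exact hu.continuousAt) (hγd 0).continuousAt
  have hc : (fun t => u (γ t)) =ᶠ[nhds 0] fun _ => u (γ 0) := by
    filter_upwards [hmax, hmin] with t h1 h2 using le_antisymm h1 h2
  have : deriv (deriv fun t => u (γ t)) 0 = 0 := by
    rw [hc.deriv.deriv_eq]; simp
  exact hpos.ne' (hdd ▸ this)

theorem leviForm_smul_left (D : E →L[ℝ] E →L[ℝ] ℝ) (c : ℂ) (v w : E) :
    leviForm D (c • v) w = c * leviForm D v w := by
  have hc : c • v = c.re • v + c.im • (Complex.I • v) := by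
    ext i
    simp only [PiLp.smul_apply, PiLp.add_apply, smul_eq_mul, Complex.real_smul]
    linear_combination (-(v i)) * Complex.re_add_im c
  have hI : Complex.I • c • v = c.re • (Complex.I • v) - c.im • v := by
    ext i
    simp only [PiLp.smul_apply, PiLp.sub_apply, smul_eq_mul, Complex.real_smul]
    linear_combination (-Complex.I * (v i)) * Complex.re_add_im c + c.im * v i * Complex.I_sq
  rw [leviForm, leviForm, hI, hc]
  simp only [map_add, map_sub, map_smul, _root_.add_apply, _root_.sub_apply, _root_.smul_apply,
    smul_eq_mul]
  push_cast
  set p : ℂ := ((D v w : ℝ) : ℂ)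
  set q : ℂ := ((D (Complex.I • v) (Complex.I • w) : ℝ) : ℂ)
  set r : ℂ := ((D v (Complex.I • w) : ℝ) : ℂ)
  set t : ℂ := ((D (Complex.I • v) w : ℝ) : ℂ)
  linear_combination ((p + q + Complex.I * (r - t)) / 4) * Complex.re_add_im c
    - c.im * (r - t) / 4 * Complex.I_sq

theorem leviForm_smul_right (D : E →L[ℝ] E →L[ℝ] ℝ) (c : ℂ) (v w : E) :
    leviForm D v (c • w) = (starRingEnd ℂ) c * leviForm D v w := by
  have hc : c • w = c.re • w + c.im • (Complex.I • w) := by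
    ext i
    simp only [PiLp.smul_apply, PiLp.add_apply, smul_eq_mul, Complex.real_smul]
    linear_combination (-(w i)) * Complex.re_add_im c
  have hI : Complex.I • c • w = c.re • (Complex.I • w) - c.im • w := by
    ext i
    simp only [PiLp.smul_apply, PiLp.sub_apply, smul_eq_mul, Complex.real_smul]
    linear_combination (-Complex.I * (w i)) * Complex.re_add_im c + c.im * w i * Complex.I_sq
  have hcc : (starRingEnd ℂ) c = c.re - c.im * Complex.I := by
    apply Complex.ext <;> simp
  rw [leviForm, leviForm, hI, hc, hcc]
  simp only [map_add, map_sub, map_smul, smul_eq_mul]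
  push_cast
  set p : ℂ := ((D v w : ℝ) : ℂ)
  set q : ℂ := ((D (Complex.I • v) (Complex.I • w) : ℝ) : ℂ)
  set r : ℂ := ((D v (Complex.I • w) : ℝ) : ℂ)
  set t : ℂ := ((D (Complex.I • v) w : ℝ) : ℂ)
  linear_combination c.im * (r - t) / 4 * Complex.I_sq

/-- The Levi form as a sesquilinear map. -/
def leviSesq (D : E →L[ℝ] E →L[ℝ] ℝ) : E →ₗ[ℂ] E →ₗ⋆[ℂ] ℂ :=
  LinearMap.mk₂'ₛₗ (RingHom.id ℂ) (starRingEnd ℂ) (leviForm D)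
    (fun v v' w => by simp [leviForm]; ring) (leviForm_smul_left D)
    (fun v w w' => by simp [leviForm]; ring) (fun c v w => leviForm_smul_right D c v w)

theorem leviForm_conj {D : E →L[ℝ] E →L[ℝ] ℝ} (hs : ∀ v w, D v w = D w v) (v w : E) :
    (starRingEnd ℂ) (leviForm D v w) = leviForm D w v := by
  rw [leviForm, leviForm, hs w v, hs (Complex.I • w) (Complex.I • v), hs w (Complex.I • v),
    hs (Complex.I • w) v]
  have h4 : (starRingEnd ℂ) 4 = 4 := Complex.conj_ofNat 4
  simp [h4]
  ring

/-- On the diagonal the Levi form is the average `(D ξ ξ + D (iξ) (iξ)) / 4`, so it inherits the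
sign of `D`. -/
theorem leviMatrix_posSemidef {D : E →L[ℝ] E →L[ℝ] ℝ} (hs : ∀ v w, D v w = D w v)
    (hD : ∀ v, 0 ≤ D v v) : (leviMatrix D).PosSemidef := by
  refine Matrix.PosSemidef.of_dotProduct_mulVec_nonneg ?_ fun x => ?_
  · ext j k
    exact leviForm_conj hs _ _
  -- The coefficients are conjugated because the Levi form is linear in its first slot, whereas the
  -- quadratic form of a matrix is conjugate-linear there.
  · set ξ : E := ∑ j, (starRingEnd ℂ) (x j) • EuclideanSpace.single j (1 : ℂ) with hξ
    have h1 : star x ⬝ᵥ (leviMatrix D).mulVec x = leviForm D ξ ξ := by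
      have : leviForm D ξ ξ = leviSesq D ξ ξ := rfl
      rw [this]
      simp only [hξ, map_sum, LinearMap.sum_apply, map_smul, LinearMap.map_smulₛₗ,
        LinearMap.smul_apply, smul_eq_mul, dotProduct, Matrix.mulVec, Finset.mul_sum]
      rw [Finset.sum_comm]
      refine Finset.sum_congr rfl fun j _ => Finset.sum_congr rfl fun k _ => ?_
      simp [leviMatrix, leviSesq]
      ring
    have h2 : leviForm D ξ ξ = ((1 / 4 * (D ξ ξ + D (Complex.I • ξ) (Complex.I • ξ)) : ℝ) : ℂ) := by
      rw [leviForm, hs (Complex.I • ξ) ξ]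
      push_cast
      ring
    rw [h1, h2]
    have := hD ξ
    have := hD (Complex.I • ξ)
    exact_mod_cast (by positivity : 0 ≤ 1 / 4 * (D ξ ξ + D (Complex.I • ξ) (Complex.I • ξ)))

/-- The Laplacian is nonpositive at a local maximum. -/
theorem laplacian_nonpos_of_isLocalMax {g : E → Matrix (Fin n) (Fin n) ℂ} {u : E → ℝ} {z : E}
    (hg : (g z).PosDef) (hu : ContDiffAt ℝ 2 u z) (hm : IsLocalMax u z) :
    laplacian g u z ≤ 0 := by
  have hD : DifferentiableAt ℝ (fderiv ℝ u) z :=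
    (hu.fderiv_right (m := 1) (by norm_num)).differentiableAt (by simp)
  have hsymm : IsSymmSndFDerivAt ℝ u z := hu.isSymmSndFDerivAt (by simp)
  have hP := leviMatrix_posSemidef (D := (-1 : ℝ) • fderiv ℝ (fderiv ℝ u) z)
    (fun v w => by simpa using hsymm v w)
    (fun v => by simpa using snd_fderiv_nonpos_of_isLocalMax hu hm v)
  have h := hg.inv.posSemidef.re_trace_mul_nonneg hP
  rw [leviMatrix_smul, Matrix.mul_smul, Matrix.trace_smul, smul_eq_mul, Complex.re_ofReal_mul,
    ← laplacian_eq hu hD.hasFDerivAt] at h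
  linarith

/-! ### Laplacians of quadratic and radial functions. -/

theorem real_inner_eq_sum (x y : E) :
    inner ℝ x y = ∑ i, ((x i).re * (y i).re + (x i).im * (y i).im) := by
  rw [PiLp.inner_apply]
  refine Finset.sum_congr rfl fun i _ => ?_
  rw [Complex.inner]
  simp
  ring

/-- The Euclidean inner product as a real bilinear form. -/
def innerForm : EuclideanSpace ℂ (Fin n) →L[ℝ] EuclideanSpace ℂ (Fin n) →L[ℝ] ℝ :=
  innerSL ℝ

theorem innerForm_apply (v w : E) : innerForm v w = inner ℝ v w := rfl

theorem leviMatrix_inner : leviMatrix ((2 : ℝ) • innerForm (n := n)) = 1 := by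
  ext j k
  simp only [leviMatrix, leviForm, Matrix.of_apply, _root_.smul_apply, innerForm_apply,
    real_inner_eq_sum]
  by_cases h : j = k
  · subst h
    simp [apply_ite Complex.re, apply_ite Complex.im]
    norm_num
  · simp [apply_ite Complex.re, apply_ite Complex.im, h, eq_comm (a := k)]

theorem contDiff_norm_sub_sq (p : E) : ContDiff ℝ 2 fun z : E => ‖z - p‖ ^ 2 :=
  (contDiff_id.sub contDiff_const).norm_sq ℝ

theorem laplacian_norm_sub_sq (g : E → Matrix (Fin n) (Fin n) ℂ) (p z : E) :
    laplacian g (fun w => ‖w - p‖ ^ 2) z = (Matrix.trace (g z)⁻¹).re := by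
  have h1 : fderiv ℝ (fun w : E => ‖w - p‖ ^ 2)
      = fun w => (2 : ℝ) • innerForm (w - p) := by
    funext w
    refine HasFDerivAt.fderiv (((hasFDerivAt_id w).sub_const p).norm_sq.congr_fderiv ?_)
    ext v
    simp [innerForm_apply]
  have h2 : HasFDerivAt (fderiv ℝ (fun w : E => ‖w - p‖ ^ 2))
      ((2 : ℝ) • innerForm (n := n)) z := by
    rw [h1]
    exact (((innerForm (n := n)).hasFDerivAt (x := z - p)).comp z
      ((hasFDerivAt_id z).sub_const p)).const_smul (2 : ℝ)
  rw [laplacian_eq (contDiff_norm_sub_sq p).contDiffAt h2, leviMatrix_inner, mul_one]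

theorem laplacian_affine (g : E → Matrix (Fin n) (Fin n) ℂ) (ℓ : E →L[ℝ] ℝ) (p z : E) :
    laplacian g (fun w => ℓ (w - p)) z = 0 := by
  have h1 : fderiv ℝ (fun w : E => ℓ (w - p)) = fun _ => ℓ := by
    funext w
    exact (ℓ.hasFDerivAt.comp w ((hasFDerivAt_id w).sub_const p)).fderiv
  have h2 : HasFDerivAt (fderiv ℝ (fun w : E => ℓ (w - p))) (0 : E →L[ℝ] E →L[ℝ] ℝ) z := by
    rw [h1]; exact hasFDerivAt_const _ _
  rw [laplacian_eq (u := fun w => ℓ (w - p)) (ℓ.contDiff.contDiffAt.comp z (by fun_prop)) h2]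
  have : leviMatrix (0 : E →L[ℝ] E →L[ℝ] ℝ) = 0 := by
    ext j k; simp [leviMatrix, leviForm]
  simp [this]

/-- The Hessian of the square of a real linear form. -/
def sqForm (ℓ : E →L[ℝ] ℝ) : E →L[ℝ] E →L[ℝ] ℝ :=
  (2 : ℝ) • ℓ.smulRight ℓ

theorem laplacian_affine_sq (g : E → Matrix (Fin n) (Fin n) ℂ) (ℓ : E →L[ℝ] ℝ) (p z : E) :
    laplacian g (fun w => ℓ (w - p) ^ 2) z
      = (Matrix.trace ((g z)⁻¹ * leviMatrix (sqForm ℓ))).re := by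
  have h0 : ∀ w, HasFDerivAt (fun w : E => ℓ (w - p)) ℓ w := fun w =>
    ℓ.hasFDerivAt.comp w ((hasFDerivAt_id w).sub_const p)
  have h1 : fderiv ℝ (fun w : E => ℓ (w - p) ^ 2) = fun w => (2 : ℝ) • ℓ (w - p) • ℓ := by
    funext w
    rw [((h0 w).pow 2).fderiv]
    ext v
    simp
    ring
  have h2 : HasFDerivAt (fderiv ℝ (fun w : E => ℓ (w - p) ^ 2)) (sqForm ℓ) z := by
    rw [h1]
    exact ((h0 z).smul_const ℓ).const_smul (2 : ℝ)
  refine laplacian_eq ?_ h2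
  exact (ℓ.contDiff.contDiffAt.comp z (by fun_prop)).pow 2

theorem leviMatrix_sqForm_posSemidef (ℓ : E →L[ℝ] ℝ) : (leviMatrix (sqForm ℓ)).PosSemidef := by
  refine leviMatrix_posSemidef (fun v w => ?_) fun v => ?_
  · simp [sqForm]; ring
  · simp [sqForm, mul_self_nonneg]

theorem leviMatrix_sqForm_ne_zero {d : E} (hd : d ≠ 0) :
    leviMatrix (sqForm (innerSL ℝ d)) ≠ 0 := by
  intro h
  apply hd
  ext j
  have hj := congrFun (congrFun h j) j
  simp only [leviMatrix, leviForm, sqForm, Matrix.of_apply, _root_.smul_apply, innerSL_apply_apply,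
    real_inner_eq_sum, ContinuousLinearMap.smulRight_apply] at hj
  have hj' := congrArg Complex.re hj
  simp [apply_ite Complex.re, apply_ite Complex.im] at hj'
  have h1 : (d j).re = 0 := by nlinarith [sq_nonneg (d j).re, sq_nonneg (d j).im]
  have h2 : (d j).im = 0 := by nlinarith [sq_nonneg (d j).re, sq_nonneg (d j).im]
  exact Complex.ext h1 h2

-- Writing `A = Pᴴ P` with `P` invertible, the trace is that of the positive semidefinite `P B Pᴴ`;
-- if it vanishes, then `P B Pᴴ = 0` and hence `B = 0`.
open scoped MatrixOrder Matrix.Norms.L2Operator in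
theorem _root_.Matrix.PosDef.re_trace_mul_pos {n : Type*} [Fintype n] [DecidableEq n]
    {A B : Matrix n n ℂ} (hA : A.PosDef) (hB : B.PosSemidef) (hB0 : B ≠ 0) :
    0 < (Matrix.trace (A * B)).re := by
  refine lt_of_le_of_ne (hA.posSemidef.re_trace_mul_nonneg hB) fun h => hB0 ?_
  obtain ⟨P, hP⟩ : ∃ P : Matrix n n ℂ, A = P.conjTranspose * P :=
    CStarAlgebra.nonneg_iff_eq_star_mul_self.1 (Matrix.nonneg_iff_posSemidef.2 hA.posSemidef)
  have hPu : IsUnit P.det := by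
    have := (Matrix.isUnit_iff_isUnit_det A).1 hA.isUnit
    rw [hP, Matrix.det_mul] at this
    exact isUnit_of_mul_isUnit_right this
  have hS := hB.mul_mul_conjTranspose_same P
  have hre : (Matrix.trace (P * B * P.conjTranspose)).re = 0 := by
    rw [h, hP, Matrix.mul_assoc P.conjTranspose, Matrix.trace_mul_comm]
  have htr : Matrix.trace (P * B * P.conjTranspose) = 0 :=
    Complex.ext hre (Complex.le_def.1 hS.trace_nonneg).2.symm
  have h0 := hS.trace_eq_zero_iff.1 htr
  have hPc : IsUnit P.conjTranspose.det := by
    rw [Matrix.det_conjTranspose]; exact hPu.star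
  calc B = P⁻¹ * (P * B * P.conjTranspose) * P.conjTranspose⁻¹ := by
        rw [Matrix.mul_assoc P, ← Matrix.mul_assoc P⁻¹, Matrix.nonsing_inv_mul _ hPu, one_mul,
          Matrix.mul_assoc, Matrix.mul_nonsing_inv _ hPc, mul_one]
    _ = 0 := by simp [h0]

section Radial

variable [NeZero n]

/-- The first coordinate, as a real-linear map. -/
def proj₀ : EuclideanSpace ℂ (Fin n) →L[ℝ] ℂ :=
  (EuclideanSpace.proj (0 : Fin n) : EuclideanSpace ℂ (Fin n) →L[ℂ] ℂ).restrictScalars ℝ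

@[simp] theorem proj₀_apply (z : E) : proj₀ z = z 0 := rfl

/-- The real inner product of the first coordinates. -/
def inner₀ : EuclideanSpace ℂ (Fin n) →L[ℝ] EuclideanSpace ℂ (Fin n) →L[ℝ] ℝ :=
  (innerSL ℝ : ℂ →L[ℝ] ℂ →L[ℝ] ℝ).bilinearComp proj₀ proj₀

theorem inner₀_apply (v w : E) :
    inner₀ v w = (v 0).re * (w 0).re + (v 0).im * (w 0).im := by
  simp [inner₀, Complex.inner]
  ring

theorem contDiffAt_radial {F : ℝ → ℝ} {z : E} (hF : ContDiffAt ℝ 2 F (‖z 0‖ ^ 2)) :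
    ContDiffAt ℝ 2 (fun w : E => F (‖w 0‖ ^ 2)) z := by
  have : ContDiffAt ℝ 2 (fun w : E => ‖w 0‖ ^ 2) z :=
    ContDiffAt.norm_sq ℝ (f := fun w : E => proj₀ w) proj₀.contDiff.contDiffAt
  exact ContDiffAt.comp z hF this

/-- The Laplacian of a function of `|z₀|`. -/
theorem laplacian_radial (g : E → Matrix (Fin n) (Fin n) ℂ) {F F' : ℝ → ℝ} {F'' : ℝ} {z : E}
    (hF : ContDiffAt ℝ 2 F (‖z 0‖ ^ 2)) (hF' : ∀ᶠ t in nhds (‖z 0‖ ^ 2), HasDerivAt F (F' t) t)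
    (hF'' : HasDerivAt F' F'' (‖z 0‖ ^ 2)) :
    laplacian g (fun w => F (‖w 0‖ ^ 2)) z
      = (F'' * ‖z 0‖ ^ 2 + F' (‖z 0‖ ^ 2)) * ((g z)⁻¹ 0 0).re := by
  have hN : ∀ w : E, HasFDerivAt (fun w : E => ‖w 0‖ ^ 2) ((2 : ℝ) • inner₀ w) w := by
    intro w
    refine ((proj₀.hasFDerivAt (x := w)).norm_sq).congr_fderiv ?_
    ext v
    simp [inner₀]
    ring
  have h1 : fderiv ℝ (fun w : E => F (‖w 0‖ ^ 2)) =ᶠ[nhds z]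
      fun w => F' (‖w 0‖ ^ 2) • (2 : ℝ) • inner₀ w := by
    filter_upwards [(hN z).continuousAt.eventually hF'] with w hw
    exact (hw.comp_hasFDerivAt w (hN w)).fderiv
  have h2 : HasFDerivAt _ (F' (‖z 0‖ ^ 2) • (2 : ℝ) • inner₀
      + (F'' • (2 : ℝ) • inner₀ z).smulRight ((2 : ℝ) • inner₀ z)) z := (((hF''.comp_hasFDerivAt z (hN z)).smul
    ((inner₀ (n := n)).hasFDerivAt (x := z) |>.const_smul (2 : ℝ)))).congr_of_eventuallyEq h1
  -- Only `z₀` enters, so the Levi matrix has a single entry, the familiar `t F'' + F'` at `t =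
  -- |z₀|²`.
  have h3 : ∀ D : E →L[ℝ] E →L[ℝ] ℝ, D = F' (‖z 0‖ ^ 2) • (2 : ℝ) • inner₀
      + (F'' • (2 : ℝ) • inner₀ z).smulRight ((2 : ℝ) • inner₀ z) → leviMatrix D
      = Matrix.single 0 0 ((F'' * ‖z 0‖ ^ 2 + F' (‖z 0‖ ^ 2) : ℝ) : ℂ) := by
    rintro D rfl
    ext j k
    have hz : ‖z 0‖ ^ 2 = (z 0).re * (z 0).re + (z 0).im * (z 0).im := by
      rw [← Complex.normSq_eq_norm_sq, Complex.normSq_apply]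
    simp only [leviMatrix, leviForm, Matrix.of_apply, _root_.add_apply, _root_.smul_apply,
      ContinuousLinearMap.smulRight_apply, inner₀_apply, Matrix.single_apply]
    generalize F' (‖z 0‖ ^ 2) = c
    rw [hz]
    by_cases hj : j = 0 <;> by_cases hk : k = 0 <;>
      simp [hj, hk, Ne.symm, eq_comm]
    ring
  rw [laplacian_eq (contDiffAt_radial hF) h2, h3 _ rfl, Matrix.trace_mul_single,
    op_smul_eq_mul, mul_comm, Complex.re_ofReal_mul]

end Radial

/-! ### The classical strong maximum principle. -/

/-- A strict maximum principle: a function with positive Laplacian on an open set whose values on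
the rest of a compact set are smaller than some value inside cannot exist. -/
theorem not_laplacian_pos {g : E → Matrix (Fin n) (Fin n) ℂ} {w : E → ℝ} {s t : Set E}
    (hs : IsOpen s) (ht : IsCompact t) (hst : s ⊆ t) (hg : ∀ x ∈ s, (g x).PosDef)
    (hw : ∀ x ∈ s, ContDiffAt ℝ 2 w x) (hwc : ContinuousOn w t)
    (hL : ∀ x ∈ s, 0 < laplacian g w x) {x₀ : E} (hx₀ : x₀ ∈ s) :
    ∃ x ∈ t \ s, w x₀ ≤ w x := by
  by_contra! hlt
  obtain ⟨x, hxs, hx⟩ := ht.exists_isLocalMax_mem_open hst hwc (hst hx₀) hlt hs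
  exact (laplacian_nonpos_of_isLocalMax (hg x hxs) (hw x hxs) hx).not_gt (hL x hxs)

/-- A subharmonic function cannot attain its maximum at a boundary point of a ball
inside which it is strictly smaller, if that point is in the interior of its domain. -/
theorem not_touching_ball {g : E → Matrix (Fin n) (Fin n) ℂ} {u : E → ℝ} {U : Set E}
    (hU : IsOpen U) (hgc : ContinuousOn g U) (hg : ∀ x ∈ U, (g x).PosDef)
    (hu : ContDiffOn ℝ 2 u U) (hL : ∀ x ∈ U, 0 ≤ laplacian g u x) {c : ℝ}
    (hc : ∀ x ∈ U, u x ≤ c) {x₀ d : E} (hx₀ : x₀ ∈ U) (hd : d ≠ 0) (hux₀ : u x₀ = c)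
    (hball : ∀ x ∈ U, ‖x - x₀ - d‖ < ‖d‖ → u x < c) : False := by
  set ℓ : E →L[ℝ] ℝ := innerSL ℝ d with hℓ
  set M := leviMatrix (sqForm ℓ) with hM
  have hMpos : 0 < (Matrix.trace ((g x₀)⁻¹ * M)).re :=
    (hg x₀ hx₀).inv.re_trace_mul_pos (leviMatrix_sqForm_posSemidef ℓ)
      (leviMatrix_sqForm_ne_zero hd)
  have hTpos : 0 ≤ (Matrix.trace (g x₀)⁻¹).re :=
    (Complex.le_def.1 (hg x₀ hx₀).inv.posSemidef.trace_nonneg).1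
  -- `K` is chosen so that `K ℓ²` outweighs `-|x - x₀|²` in the Laplacian at `x₀`, and then nearby
  -- by continuity.
  obtain ⟨K, hK0, hK⟩ : ∃ K : ℝ, 0 < K ∧
      (Matrix.trace (g x₀)⁻¹).re < K * (Matrix.trace ((g x₀)⁻¹ * M)).re := by
    refine ⟨((Matrix.trace (g x₀)⁻¹).re + 1) / (Matrix.trace ((g x₀)⁻¹ * M)).re, by positivity, ?_⟩
    rw [div_mul_cancel₀ _ hMpos.ne']
    linarith
  have hinv : ContinuousAt (fun x => (g x)⁻¹) x₀ := by
    have h1 : ContinuousAt g x₀ := hgc.continuousAt (hU.mem_nhds hx₀)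
    have hdet : (g x₀).det ≠ 0 := (hg x₀ hx₀).det_pos.ne'
    refine ContinuousAt.comp (g := fun A : Matrix (Fin n) (Fin n) ℂ => A⁻¹) ?_ h1
    refine continuousAt_matrix_inv _ ?_
    exact NormedRing.inverse_continuousAt (Units.mk0 _ hdet)
  have htr : Continuous fun A : Matrix (Fin n) (Fin n) ℂ =>
      K * (Matrix.trace (A * M)).re - (Matrix.trace A).re :=
    (continuous_const.mul (Complex.continuous_re.comp
      (continuous_id.matrix_mul continuous_const).matrix_trace)).sub
      (Complex.continuous_re.comp continuous_id.matrix_trace)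
  have hq : ∀ᶠ x in nhds x₀, 0 < K * (Matrix.trace ((g x)⁻¹ * M)).re - (Matrix.trace (g x)⁻¹).re :=
    (htr.continuousAt.comp hinv).eventually (lt_mem_nhds (by simpa using hK))
  obtain ⟨r, hr0, hr⟩ := Metric.nhds_basis_closedBall.eventually_iff.1
    (hq.and (hU.mem_nhds hx₀ : ∀ᶠ x in nhds x₀, x ∈ U))
  have hdn : 0 < ‖d‖ := norm_pos_iff.2 hd
  -- The second bound forces `K |ℓ| ≤ 1/2` on the ball of radius `ρ`.
  set ρ : ℝ := min r (1 / (2 * K * ‖d‖)) with hρ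
  have hρ0 : 0 < ρ := lt_min hr0 (by positivity)
  have hρK : K * (‖d‖ * ρ) ≤ 1 / 2 := by
    calc K * (‖d‖ * ρ) ≤ K * (‖d‖ * (1 / (2 * K * ‖d‖))) := by gcongr; exact min_le_right _ _
      _ = 1 / 2 := by field_simp
  have hsub : ∀ x ∈ Metric.closedBall x₀ ρ, x ∈ Metric.closedBall x₀ r := fun x hx =>
    Metric.closedBall_subset_closedBall (min_le_left _ _) hx
  have hℓb : ∀ x ∈ Metric.closedBall x₀ ρ, |ℓ (x - x₀)| ≤ ‖d‖ * ρ := by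
    intro x hx
    calc |ℓ (x - x₀)| ≤ ‖d‖ * ‖x - x₀‖ := abs_real_inner_le_norm d (x - x₀)
      _ ≤ _ := by gcongr; rwa [← dist_eq_norm]
  -- A quadratic Hopf-type barrier: it vanishes at `x₀`, is strictly subharmonic nearby, and is
  -- negative outside the touching ball.
  set v : E → ℝ := fun x => ℓ (x - x₀) + K * ℓ (x - x₀) ^ 2 + (-1) * ‖x - x₀‖ ^ 2 with hv
  have hv1 : ContDiff ℝ 2 fun x : E => ℓ (x - x₀) := ℓ.contDiff.comp (by fun_prop)
  have hv2 : ContDiff ℝ 2 fun x : E => ‖x - x₀‖ ^ 2 := contDiff_norm_sub_sq x₀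
  have hvC : ContDiff ℝ 2 v := (hv1.add (contDiff_const.mul (hv1.pow 2))).add
    (contDiff_const.mul hv2)
  have hvL : ∀ x, laplacian g v x
      = K * (Matrix.trace ((g x)⁻¹ * M)).re - (Matrix.trace (g x)⁻¹).re := by
    intro x
    rw [hv, laplacian_add (u := fun x : E => ℓ (x - x₀) + K * ℓ (x - x₀) ^ 2)
        (hv1.add (contDiff_const.mul (hv1.pow 2))).contDiffAt
        (contDiff_const.mul hv2).contDiffAt,
      laplacian_add (u := fun x : E => ℓ (x - x₀)) hv1.contDiffAt
        (contDiff_const.mul (hv1.pow 2)).contDiffAt,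
      laplacian_const_mul K (hv1.pow 2).contDiffAt, laplacian_const_mul (-1) hv2.contDiffAt,
      laplacian_affine, laplacian_affine_sq, laplacian_norm_sub_sq]
    ring
  set V : ℝ := ‖d‖ * ρ + K * (‖d‖ * ρ) ^ 2 with hV
  have hV0 : 0 < V := by positivity
  have hvV : ∀ x ∈ Metric.closedBall x₀ ρ, v x ≤ V := by
    intro x hx
    have h1 := hℓb x hx
    have h2 : ℓ (x - x₀) ^ 2 ≤ (‖d‖ * ρ) ^ 2 := by
      rw [← sq_abs]; gcongr
    have h3 := le_of_abs_le h1
    have h4 : K * ℓ (x - x₀) ^ 2 ≤ K * (‖d‖ * ρ) ^ 2 := by gcongr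
    simp only [hv, hV]
    nlinarith [sq_nonneg ‖x - x₀‖]
  -- The touching ball is `|x - x₀|² < 2ℓ`, while `v ≥ 0` means `|x - x₀|² ≤ ℓ (1 + K ℓ)`. Since `|K
  -- ℓ| ≤ 1/2` and `x ≠ x₀`, this gives `ℓ > 0` and a right side at most `3ℓ/2`.
  have hvneg : ∀ x ∈ Metric.closedBall x₀ ρ, x ≠ x₀ → 0 ≤ v x → ‖x - x₀ - d‖ < ‖d‖ := by
    intro x hx hne h0
    by_contra! hge
    have hX : 0 < ‖x - x₀‖ ^ 2 := by
      have := norm_pos_iff.2 (sub_ne_zero.2 hne)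
      positivity
    have h1 : ‖x - x₀ - d‖ ^ 2 = ‖x - x₀‖ ^ 2 - 2 * ℓ (x - x₀) + ‖d‖ ^ 2 := by
      rw [norm_sub_sq_real, real_inner_comm]; rfl
    have h2 : ‖d‖ ^ 2 ≤ ‖x - x₀ - d‖ ^ 2 := by gcongr
    have h3 := abs_le.1 (hℓb x hx)
    set s := ℓ (x - x₀) with hs
    have h4 : K * s ≤ 1 / 2 := by nlinarith
    have h5 : -(1 / 2) ≤ K * s := by nlinarith
    have h6 : 0 ≤ s + K * s ^ 2 + (-1) * ‖x - x₀‖ ^ 2 := h0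
    rcases le_or_gt s 0 with hs0 | hs0
    · nlinarith
    · nlinarith
  have hxU : ∀ x ∈ Metric.closedBall x₀ ρ, x ∈ U := fun x hx => (hr (hsub x hx)).2
  have huc : ContinuousOn u (Metric.closedBall x₀ ρ) := hu.continuousOn.mono hxU
  obtain ⟨c', hc', hS⟩ : ∃ c', c' < c ∧ ∀ x ∈ Metric.sphere x₀ ρ ∩ {x | 0 ≤ v x}, u x ≤ c' := by
    have hcpt : IsCompact (Metric.sphere x₀ ρ ∩ {x | 0 ≤ v x}) :=
      (isCompact_sphere x₀ ρ).inter_right (isClosed_le continuous_const hvC.continuous)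
    have hlt : ∀ x ∈ Metric.sphere x₀ ρ ∩ {x | 0 ≤ v x}, 0 < c - u x := by
      intro x hx
      rw [sub_pos]
      have hxb := Metric.sphere_subset_closedBall hx.1
      refine hball x (hxU x hxb) (hvneg x hxb ?_ hx.2)
      rintro rfl
      simpa [hρ0.ne] using hx.1
    obtain ⟨a, ha, h⟩ := hcpt.exists_forall_le'
      (continuousOn_const.sub (huc.mono fun x hx => Metric.sphere_subset_closedBall hx.1)) hlt
    exact ⟨c - a, by linarith, fun x hx => le_sub_comm.1 (h x hx)⟩
  -- On the sphere, `u + ε v` stays below `c`: where `v ≥ 0` it is at most `c' + (c - c') / 2`, and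
  -- where `v < 0` because `u ≤ c`. At the centre it equals `c`.
  set ε : ℝ := (c - c') / (2 * V) with hε
  have hε0 : 0 < ε := div_pos (by linarith) (by positivity)
  have hεV : ε * V = (c - c') / 2 := by rw [hε]; field_simp
  have hcd : ∀ x ∈ U, ContDiffAt ℝ 2 u x := fun x hx => hu.contDiffAt (hU.mem_nhds hx)
  obtain ⟨x, hx, hle⟩ := not_laplacian_pos (g := g) (w := fun x => u x + ε * v x)
    Metric.isOpen_ball (isCompact_closedBall x₀ ρ) Metric.ball_subset_closedBall
    (fun x hx => hg x (hxU x (Metric.ball_subset_closedBall hx)))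
    (fun x hx => (hcd x (hxU x (Metric.ball_subset_closedBall hx))).add
      (contDiffAt_const.mul hvC.contDiffAt))
    (huc.add (continuous_const.mul hvC.continuous).continuousOn)
    (fun x hx => by
      have hxb := Metric.ball_subset_closedBall hx
      rw [laplacian_add (hcd x (hxU x hxb)) (contDiffAt_const.mul hvC.contDiffAt),
        laplacian_const_mul ε hvC.contDiffAt, hvL]
      have h1 := hL x (hxU x hxb)
      have h2 := mul_pos hε0 (hr (hsub x hxb)).1
      linarith)
    (Metric.mem_ball_self hρ0)
  rw [Metric.closedBall_sdiff_ball] at hx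
  have hxb := Metric.sphere_subset_closedBall hx
  have hx0 : v x₀ = 0 := by simp [hv]
  simp only [hux₀, hx0, mul_zero, add_zero] at hle
  rcases le_or_gt 0 (v x) with h0 | h0
  · have h1 := hS x ⟨hx, h0⟩
    have h2 : ε * v x ≤ ε * V := by gcongr; exact hvV x hxb
    linarith
  · have := mul_neg_of_pos_of_neg hε0 h0
    have := hc x (hxU x hxb)
    linarith

/-- The classical strong maximum principle: the set where a subharmonic function attains its
maximum is open. -/
theorem eventually_eq_of_max {g : E → Matrix (Fin n) (Fin n) ℂ} {u : E → ℝ} {U : Set E}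
    (hU : IsOpen U) (hgc : ContinuousOn g U) (hg : ∀ x ∈ U, (g x).PosDef)
    (hu : ContDiffOn ℝ 2 u U) (hL : ∀ x ∈ U, 0 ≤ laplacian g u x) {c : ℝ}
    (hc : ∀ x ∈ U, u x ≤ c) {x₁ : E} (hx₁ : x₁ ∈ U) (hux₁ : u x₁ = c) :
    ∀ᶠ x in nhds x₁, u x = c := by
  obtain ⟨r, hr0, hr⟩ := Metric.isOpen_iff.1 hU x₁ hx₁
  refine Metric.eventually_nhds_iff_ball.2 ⟨r / 2, by positivity, fun y hy => ?_⟩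
  by_contra hne
  have hyx : dist y x₁ < r / 2 := hy
  have hsub : Metric.closedBall y (dist y x₁) ⊆ U := fun x hx => hr <| by
    have h1 : dist x y ≤ dist y x₁ := hx
    have := dist_triangle x y x₁
    exact Metric.mem_ball.2 (by linarith)
  have huc : ContinuousOn u (Metric.closedBall y (dist y x₁)) := hu.continuousOn.mono hsub
  set Z := Metric.closedBall y (dist y x₁) ∩ u ⁻¹' {c} with hZ
  have hZc : IsCompact Z :=
    (isCompact_closedBall y _).of_isClosed_subset
      (huc.preimage_isClosed_of_isClosed Metric.isClosed_closedBall isClosed_singleton)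
      Set.inter_subset_left
  have hx₁Z : x₁ ∈ Z := ⟨by rw [Metric.mem_closedBall, dist_comm], hux₁⟩
  -- The point of the maximum set nearest to `y` is touched by a ball centred at `y` whose interior
  -- misses that set.
  obtain ⟨x₀, hx₀, hmin⟩ := hZc.exists_isMinOn ⟨x₁, hx₁Z⟩
    (f := fun x => dist x y) (by fun_prop)
  have hx₀c : u x₀ = c := hx₀.2
  refine not_touching_ball hU hgc hg hu hL hc (x₀ := x₀) (d := y - x₀) (hsub hx₀.1) ?_ hx₀c ?_
  · intro h
    exact hne (by rw [sub_eq_zero.1 h, hx₀c])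
  · intro x hx hlt
    rw [sub_sub, add_sub_cancel, ← dist_eq_norm, ← dist_eq_norm, dist_comm y] at hlt
    refine lt_of_le_of_ne (hc x hx) fun hxc => ?_
    have hxZ : x ∈ Z := ⟨Metric.mem_closedBall.2 (hlt.le.trans hx₀.1), hxc⟩
    exact (hmin hxZ : dist x₀ y ≤ dist x y).not_gt hlt

theorem eq_of_max {g : E → Matrix (Fin n) (Fin n) ℂ} {u : E → ℝ} {U : Set E}
    (hU : IsOpen U) (hUc : IsPreconnected U) (hgc : ContinuousOn g U)
    (hg : ∀ x ∈ U, (g x).PosDef)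
    (hu : ContDiffOn ℝ 2 u U) (hL : ∀ x ∈ U, 0 ≤ laplacian g u x) {c : ℝ}
    (hc : ∀ x ∈ U, u x ≤ c) {x₁ : E} (hx₁ : x₁ ∈ U) (hux₁ : u x₁ = c) :
    ∀ x ∈ U, u x = c := by
  by_contra! hne
  obtain ⟨x₂, hx₂, hux₂⟩ := hne
  have h1 : IsOpen (U ∩ u ⁻¹' {c}ᶜ) := hu.continuousOn.isOpen_inter_preimage hU isOpen_compl_singleton
  have h2 : IsOpen {x | x ∈ U ∧ u x = c} := isOpen_iff_mem_nhds.2 fun x hx =>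
    Filter.inter_mem (hU.mem_nhds hx.1)
      (eventually_eq_of_max hU hgc hg hu hL hc hx.1 hx.2)
  obtain ⟨x, -, hxa, hxb⟩ := hUc _ _ h1 h2
    (fun x hx => (em (u x = c)).elim (fun h => Or.inr ⟨hx, h⟩) fun h => Or.inl ⟨hx, h⟩)
    ⟨x₂, hx₂, hx₂, hux₂⟩ ⟨x₁, hx₁, hx₁, hux₁⟩
  exact hxa.2 hxb.2

/-! ### The barrier at the divisor. -/

variable [NeZero n]

theorem mem_divisor_iff {z : E} : z ∈ divisor n ↔ z 0 = 0 := Iff.rfl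

theorem norm_sub_two_rpow (β x : ℝ) (hx : 0 < x) : x ^ (2 * β - 2) = (x ^ 2) ^ (β - 1) := by
  rw [← Real.rpow_natCast x 2, ← Real.rpow_mul hx.le]
  congr 1
  push_cast
  ring

/-- Pairing `A ≥ C⁻¹ ω_β` with `A⁻¹` gives `tr (A⁻¹ ω_β) ≤ C n`, and `ω_β ≥ β²` where `|z₀| ≤ 1`,
because `2β - 2 < 0` and `β < 1`. -/
theorem trace_inv_le {β C : ℝ} (hβ₀ : 0 < β) (hβ₁ : β < 1) (hC : 0 < C)
    {A : Matrix (Fin n) (Fin n) ℂ} (hA : A.PosDef) {z : E} (hz : z ∉ divisor n)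
    (hz1 : ‖z 0‖ ≤ 1) (hAC : (A - C⁻¹ • modelCone β z).PosSemidef) :
    (Matrix.trace A⁻¹).re ≤ C * n / β ^ 2 := by
  have hz0 : 0 < ‖z 0‖ := norm_pos_iff.2 hz
  have hu : IsUnit A.det := (Matrix.isUnit_iff_isUnit_det A).1 hA.isUnit
  have h1 := hA.inv.posSemidef.re_trace_mul_nonneg hAC
  rw [Matrix.mul_sub, Matrix.nonsing_inv_mul _ hu, Matrix.trace_sub, Matrix.mul_smul,
    Matrix.trace_smul, Matrix.trace_one, Complex.sub_re, Complex.smul_re, smul_eq_mul] at h1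
  have hdiag : (modelCone β z - (β ^ 2 : ℝ) • (1 : Matrix (Fin n) (Fin n) ℂ)).PosSemidef := by
    have : modelCone β z - (β ^ 2 : ℝ) • (1 : Matrix (Fin n) (Fin n) ℂ)
        = Matrix.diagonal fun j => (((if j = 0 then β ^ 2 * ‖z 0‖ ^ (2 * β - 2) else 1)
          - β ^ 2 : ℝ) : ℂ) := by
      rw [modelCone, ← Matrix.diagonal_one, ← Matrix.diagonal_smul, Matrix.diagonal_sub]
      congr 1
      funext j
      by_cases hj : j = 0 <;> simp [hj]
    rw [this, Matrix.posSemidef_diagonal_iff]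
    intro j
    have : (0 : ℝ) ≤ (if j = 0 then β ^ 2 * ‖z 0‖ ^ (2 * β - 2) else 1) - β ^ 2 := by
      split_ifs
      · have := Real.one_le_rpow_of_pos_of_le_one_of_nonpos hz0 hz1
          (by linarith : 2 * β - 2 ≤ 0)
        nlinarith [sq_nonneg β]
      · nlinarith
    exact_mod_cast this
  have h2 := hA.inv.posSemidef.re_trace_mul_nonneg hdiag
  rw [Matrix.mul_sub, Matrix.trace_sub, Matrix.mul_smul, mul_one,
    Matrix.trace_smul, Complex.sub_re, Complex.smul_re, smul_eq_mul] at h2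
  have h3 : ((Fintype.card (Fin n) : ℂ)).re = n := by simp
  rw [h3] at h1
  rw [le_div_iff₀ (by positivity)]
  have h4 : (Matrix.trace (A⁻¹ * modelCone β z)).re ≤ C * n := by
    have := mul_le_mul_of_nonneg_left (sub_nonneg.1 h1) hC.le
    rwa [← mul_assoc, mul_inv_cancel₀ hC.ne', one_mul] at this
  linarith

/-- The quantity bounded here is the Laplacian of `|z₀|^(2β)`. The upper bound on the metric
controls `A₀₀`, and Cauchy-Schwarz passes to the inverse. -/
theorem inv_diag_ge {β C : ℝ} (hC : 0 < C)
    {A : Matrix (Fin n) (Fin n) ℂ} (hA : A.PosDef) {z : E} (hz : z ∉ divisor n)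
    (hAC : (C • modelCone β z - A).PosSemidef) :
    1 / C ≤ β ^ 2 * ‖z 0‖ ^ (2 * β - 2) * (A⁻¹ 0 0).re := by
  have hz0 : 0 < ‖z 0‖ := norm_pos_iff.2 hz
  have h1 := hA.one_le_re_mul_inv_diag 0
  have h2 := (Complex.le_def.1 (hAC.diag_nonneg (i := 0))).1
  have h3 : (A 0 0).re ≤ C * (β ^ 2 * ‖z 0‖ ^ (2 * β - 2)) := by
    rw [Matrix.sub_apply, Matrix.smul_apply, modelCone, Matrix.diagonal_apply_eq, if_pos rfl,
      Complex.sub_re, Complex.smul_re, Complex.ofReal_re, Complex.zero_re, smul_eq_mul] at h2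
    linarith
  have h4 : 0 ≤ (A⁻¹ 0 0).re := (Complex.le_def.1 hA.inv.posSemidef.diag_nonneg).1
  rw [div_le_iff₀ hC]
  nlinarith [mul_le_mul_of_nonneg_right h3 h4]

/-- The radial part of the barrier at a point of the divisor. -/
theorem laplacian_rpow_add_log (g : E → Matrix (Fin n) (Fin n) ℂ) (A β ε : ℝ) {z : E}
    (hz : z ∉ divisor n) :
    ContDiffAt ℝ 2 (fun w : E => A * (‖w 0‖ ^ 2) ^ β + ε / 2 * Real.log (‖w 0‖ ^ 2)) z ∧
    laplacian g (fun w => A * (‖w 0‖ ^ 2) ^ β + ε / 2 * Real.log (‖w 0‖ ^ 2)) z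
      = A * (β ^ 2 * ‖z 0‖ ^ (2 * β - 2) * ((g z)⁻¹ 0 0).re) := by
  have hz0 : 0 < ‖z 0‖ := norm_pos_iff.2 hz
  have ht : 0 < ‖z 0‖ ^ 2 := by positivity
  have hF : ContDiffAt ℝ 2 (fun t : ℝ => A * t ^ β + ε / 2 * Real.log t) (‖z 0‖ ^ 2) :=
    (contDiffAt_const.mul (Real.contDiffAt_rpow_const_of_ne ht.ne')).add
      (contDiffAt_const.mul (Real.contDiffAt_log.2 ht.ne'))
  refine ⟨contDiffAt_radial hF, ?_⟩
  have hF' : ∀ᶠ t in nhds (‖z 0‖ ^ 2), HasDerivAt (fun t : ℝ => A * t ^ β + ε / 2 * Real.log t)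
      (A * (β * t ^ (β - 1)) + ε / 2 * t⁻¹) t := by
    filter_upwards [lt_mem_nhds ht] with t ht
    exact ((Real.hasDerivAt_rpow_const (Or.inl ht.ne')).const_mul A).add
      ((Real.hasDerivAt_log ht.ne').const_mul (ε / 2))
  have hF'' : HasDerivAt (fun t : ℝ => A * (β * t ^ (β - 1)) + ε / 2 * t⁻¹)
      (A * (β * ((β - 1) * (‖z 0‖ ^ 2) ^ (β - 1 - 1))) + ε / 2 * -((‖z 0‖ ^ 2) ^ 2)⁻¹)
      (‖z 0‖ ^ 2) :=
    (((Real.hasDerivAt_rpow_const (Or.inl ht.ne')).const_mul β).const_mul A).add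
      ((hasDerivAt_inv ht.ne').const_mul (ε / 2))
  rw [laplacian_radial g hF hF' hF'', norm_sub_two_rpow β _ hz0]
  have h1 : (‖z 0‖ ^ 2) ^ (β - 1 - 1) = (‖z 0‖ ^ 2) ^ (β - 1) / ‖z 0‖ ^ 2 := by
    rw [Real.rpow_sub_one ht.ne']
  rw [h1]
  field_simp
  ring

/-- A bounded subharmonic function which is smaller than `c` near a point of the divisor has
upper limit smaller than `c` there. -/
theorem eventually_le_sub_of_lt {β C : ℝ} (hβ₀ : 0 < β) (hβ₁ : β < 1) (hC : 0 < C)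
    {g : E → Matrix (Fin n) (Fin n) ℂ} {u : E → ℝ} {p : E} {R c : ℝ} {Ω : Set E}
    (hΩ : IsOpen Ω) (hg : ∀ z ∈ Ω \ divisor n, (g z).PosDef)
    (hgC : ∀ z ∈ Ω \ divisor n,
      (g z - C⁻¹ • modelCone β z).PosSemidef ∧ (C • modelCone β z - g z).PosSemidef)
    (hu : ContDiffOn ℝ 2 u (Ω \ divisor n)) (hL : ∀ z ∈ Ω \ divisor n, 0 ≤ laplacian g u z)
    (hp : p ∈ divisor n) (hR : 0 < R) (hRΩ : Metric.closedBall p R ⊆ Ω)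
    (hc : ∀ z ∈ Metric.closedBall p R \ divisor n, u z < c) :
    ∃ δ > 0, ∀ᶠ z in nhds p, z ∉ divisor n → u z ≤ c - δ := by
  have hcont0 : Continuous fun z : E => ‖z 0‖ := (proj₀ (n := n)).continuous.norm
  have hDo : IsOpen (Ω \ divisor n) := by
    refine hΩ.sdiff ?_
    exact isClosed_eq (proj₀ (n := n)).continuous continuous_const
  have hcd : ∀ x ∈ Ω \ divisor n, ContDiffAt ℝ 2 u x := fun x hx =>
    hu.contDiffAt (hDo.mem_nhds hx)
  set T : ℝ := C * n / β ^ 2 with hT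
  have hT0 : 0 ≤ T := by positivity
  -- Then `B / C = T + 1` exceeds the bound `T` for the Laplacian of `|z - p|²` by one.
  set B : ℝ := C * (T + 1) with hB
  have hB0 : 0 < B := by positivity
  obtain ⟨r, hr0, hr1, hrB⟩ : ∃ r : ℝ, 0 < r ∧ r ≤ 1 ∧ B * (r ^ 2) ^ β ≤ R ^ 2 / 2 := by
    have h1 : Filter.Tendsto (fun r : ℝ => B * (r ^ 2) ^ β) (nhds 0) (nhds 0) := by
      have : ContinuousAt (fun r : ℝ => B * (r ^ 2) ^ β) 0 :=
        continuousAt_const.mul ((continuousAt_id.pow 2).rpow_const (Or.inr hβ₀.le))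
      simpa [ContinuousAt, Real.zero_rpow hβ₀.ne'] using this
    obtain ⟨d, hd0, hd⟩ := Metric.eventually_nhds_iff_ball.1
      (h1.eventually (gt_mem_nhds (by positivity : 0 < R ^ 2 / 2)))
    refine ⟨min (d / 2) 1, by positivity, min_le_right _ _, (hd _ ?_).le⟩
    rw [mem_ball_zero_iff, Real.norm_of_nonneg (by positivity)]
    exact (min_le_left _ _).trans_lt (by linarith)
  -- The slice `|z₀| = r` is compact and misses `D`, so the strict inequality is uniform there.
  obtain ⟨δ, hδ0, hδ⟩ : ∃ δ > 0, ∀ z ∈ Metric.closedBall p R ∩ {z | ‖z 0‖ = r}, u z ≤ c - δ := by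
    have hcpt : IsCompact (Metric.closedBall p R ∩ {z : E | ‖z 0‖ = r}) :=
      (isCompact_closedBall p R).inter_right (isClosed_eq hcont0 continuous_const)
    have hnD : ∀ z ∈ Metric.closedBall p R ∩ {z : E | ‖z 0‖ = r}, z ∉ divisor n := by
      intro z hz hzD
      have : ‖z 0‖ = r := hz.2
      rw [mem_divisor_iff.1 hzD, norm_zero] at this
      exact hr0.ne this
    obtain ⟨a, ha, h⟩ := hcpt.exists_forall_le' (f := fun z => c - u z) (a := 0)
      (continuousOn_const.sub (hu.continuousOn.mono fun z hz => ⟨hRΩ hz.1, hnD z hz⟩))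
      fun z hz => sub_pos.2 (hc z ⟨hz.1, hnD z hz⟩)
    exact ⟨a, ha, fun z hz => le_sub_comm.1 (h z hz)⟩
  set a : ℝ := δ / R ^ 2 with ha
  have ha0 : 0 < a := by positivity
  have haR : a * R ^ 2 = δ := by rw [ha]; field_simp
  refine ⟨a * R ^ 2 / 4, by positivity, ?_⟩
  have hp0 : ‖p 0‖ < r := by rw [mem_divisor_iff.1 hp, norm_zero]; exact hr0
  filter_upwards [Metric.ball_mem_nhds p (half_pos hR),
    hcont0.continuousAt.eventually (gt_mem_nhds hp0)] with y hyR hyr hyD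
  have hy0 : 0 < ‖y 0‖ := norm_pos_iff.2 hyD
  have hlogle : 0 ≤ Real.log r - Real.log ‖y 0‖ :=
    sub_nonneg.2 (Real.log_le_log hy0 hyr.le)
  have key : ∀ ε > 0, u y ≤ c - a * R ^ 2 / 4 + ε * (Real.log r - Real.log ‖y 0‖) := by
    intro ε hε
    -- The first term makes `ε log |z₀|` at least `δ` lower on the inner wall `|z₀| = η` than on
    -- `|z₀| = r`; the second keeps `y` inside the region.
    set η : ℝ := min (r * Real.exp (-(δ / ε))) (‖y 0‖ / 2) with hη
    have hη0 : 0 < η := lt_min (mul_pos hr0 (Real.exp_pos _)) (by positivity)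
    have hηy : η < ‖y 0‖ := (min_le_right _ _).trans_lt (by linarith)
    have hηlog : ε * Real.log η ≤ ε * Real.log r - δ := by
      have h1 : Real.log η ≤ Real.log r + -(δ / ε) := by
        rw [← Real.log_exp (-(δ / ε)), ← Real.log_mul hr0.ne' (Real.exp_pos _).ne']
        exact Real.log_le_log hη0 (min_le_left _ _)
      calc ε * Real.log η ≤ ε * (Real.log r + -(δ / ε)) := by gcongr
        _ = _ := by field_simp; ring
    set s : Set E := Metric.ball p R ∩ {z | η < ‖z 0‖ ∧ ‖z 0‖ < r} with hs
    set t : Set E := Metric.closedBall p R ∩ {z | η ≤ ‖z 0‖ ∧ ‖z 0‖ ≤ r} with ht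
    have hst : s ⊆ t := fun z hz =>
      ⟨Metric.ball_subset_closedBall hz.1, hz.2.1.le, hz.2.2.le⟩
    have htD : ∀ z ∈ t, z ∉ divisor n := by
      intro z hz hzD
      have : η ≤ ‖z 0‖ := hz.2.1
      rw [mem_divisor_iff.1 hzD, norm_zero] at this
      linarith
    have htΩ : ∀ z ∈ t, z ∈ Ω \ divisor n := fun z hz => ⟨hRΩ hz.1, htD z hz⟩
    have hso : IsOpen s := Metric.isOpen_ball.inter
      ((isOpen_lt continuous_const hcont0).inter (isOpen_lt hcont0 continuous_const))
    have htc : IsCompact t := (isCompact_closedBall p R).inter_right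
      ((isClosed_le continuous_const hcont0).inter (isClosed_le hcont0 continuous_const))
    set φ : E → ℝ := fun z => a * B * (‖z 0‖ ^ 2) ^ β + ε / 2 * Real.log (‖z 0‖ ^ 2) with hφ
    have hφC : ∀ z ∉ divisor n, ContDiffAt ℝ 2 φ z := fun z hz =>
      (laplacian_rpow_add_log g (a * B) β ε hz).1
    have hq : ContDiff ℝ 2 fun z : E => ‖z - p‖ ^ 2 := contDiff_norm_sub_sq p
    set w : E → ℝ := fun z => u z + φ z + (-a) * ‖z - p‖ ^ 2 with hw
    have hwC : ∀ z ∈ t, ContDiffAt ℝ 2 w z := fun z hz =>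
      ((hcd z (htΩ z hz)).add (hφC z (htD z hz))).add (contDiffAt_const.mul hq.contDiffAt)
    have hwL : ∀ z ∈ s, 0 < laplacian g w z := by
      intro z hzs
      have hz := hst hzs
      have hzD := htD z hz
      have hzΩ := htΩ z hz
      rw [hw, laplacian_add (u := fun z => u z + φ z) ((hcd z hzΩ).add (hφC z hzD))
          (contDiffAt_const.mul hq.contDiffAt), laplacian_add (hcd z hzΩ) (hφC z hzD),
        laplacian_const_mul _ hq.contDiffAt, laplacian_norm_sub_sq, hφ,
        (laplacian_rpow_add_log g (a * B) β ε hzD).2]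
      have h1 := hL z hzΩ
      have h2 := trace_inv_le hβ₀ hβ₁ hC (hg z hzΩ) hzD (hz.2.2.trans hr1) (hgC z hzΩ).1
      have h3 := inv_diag_ge hC (hg z hzΩ) hzD (hgC z hzΩ).2
      have h4 : a * (T + 1) ≤ a * B * (β ^ 2 * ‖z 0‖ ^ (2 * β - 2) * ((g z)⁻¹ 0 0).re) :=
        calc a * (T + 1) = a * B * (1 / C) := by rw [hB]; field_simp
          _ ≤ _ := by gcongr
      have h5 : a * (Matrix.trace (g z)⁻¹).re ≤ a * T := by gcongr
      linarith
    have hys : y ∈ s := ⟨Metric.ball_subset_ball (by linarith) hyR, hηy, hyr⟩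
    obtain ⟨x, ⟨hxt, hxs⟩, hle⟩ := not_laplacian_pos hso htc hst
      (fun z hz => hg z (htΩ z (hst hz))) (fun z hz => hwC z (hst hz))
      (fun z hz => (hwC z hz).continuousAt.continuousWithinAt) hwL hys
    have hx0 : 0 < ‖x 0‖ := hη0.trans_le hxt.2.1
    have hlog : ∀ z : E, ε / 2 * Real.log (‖z 0‖ ^ 2) = ε * Real.log ‖z 0‖ := fun z => by
      rw [Real.log_pow]; push_cast; ring
    have hux : u x < c := hc x ⟨hxt.1, htD x hxt⟩
    have hxB : a * B * (‖x 0‖ ^ 2) ^ β ≤ δ / 2 := by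
      have h1 : (‖x 0‖ ^ 2) ^ β ≤ (r ^ 2) ^ β := by
        refine Real.rpow_le_rpow (by positivity) ?_ hβ₀.le
        have := hxt.2.2
        gcongr
      calc a * B * (‖x 0‖ ^ 2) ^ β = a * (B * (‖x 0‖ ^ 2) ^ β) := by ring
        _ ≤ a * (R ^ 2 / 2) := by
          gcongr
          exact (mul_le_mul_of_nonneg_left h1 hB0.le).trans hrB
        _ = δ / 2 := by rw [← haR]; ring
    have hxlog : ε * Real.log ‖x 0‖ ≤ ε * Real.log r := by
      have := Real.log_le_log hx0 hxt.2.2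
      gcongr
    have hxp : 0 ≤ a * ‖x - p‖ ^ 2 := by positivity
    -- The radial term costs at most `δ / 2`, and each piece of the boundary gains `δ`: from the
    -- logarithm on `|z₀| = η`, from compactness on `|z₀| = r`, and from `a R² = δ` on the outer
    -- sphere.
    have hwx : w x ≤ c - δ / 2 + ε * Real.log r := by
      simp only [hw, hφ, hlog]
      by_cases hxη : ‖x 0‖ = η
      · rw [hxη] at hxlog hxB ⊢
        linarith
      by_cases hxr : ‖x 0‖ = r
      · have := hδ x ⟨hxt.1, hxr⟩
        linarith
      · have hxR : ‖x - p‖ = R := by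
          refine le_antisymm (mem_closedBall_iff_norm.1 hxt.1) (not_lt.1 fun h => hxs ?_)
          exact ⟨mem_ball_iff_norm.2 h, lt_of_le_of_ne hxt.2.1 (Ne.symm hxη),
            lt_of_le_of_ne hxt.2.2 hxr⟩
        rw [hxR]
        linarith
    have hyB : 0 ≤ a * B * (‖y 0‖ ^ 2) ^ β := by positivity
    have hyp : a * ‖y - p‖ ^ 2 ≤ δ / 4 := by
      have h1 : ‖y - p‖ ≤ R / 2 := (mem_ball_iff_norm.1 hyR).le
      calc a * ‖y - p‖ ^ 2 ≤ a * (R / 2) ^ 2 := by gcongr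
        _ = δ / 4 := by rw [← haR]; ring
    have hwy := hle.trans hwx
    simp only [hw, hφ, hlog] at hwy
    rw [haR]
    linarith
  -- Now `ε → 0` with `y` fixed; `η` has disappeared from the estimate.
  refine le_of_forall_pos_le_add fun θ hθ => ?_
  have h1 : 0 < Real.log r - Real.log ‖y 0‖ + 1 := by linarith
  refine (key (θ / (Real.log r - Real.log ‖y 0‖ + 1)) (by positivity)).trans ?_
  have h2 : θ / (Real.log r - Real.log ‖y 0‖ + 1) * (Real.log r - Real.log ‖y 0‖) ≤ θ := by
    rw [div_mul_eq_mul_div, div_le_iff₀ h1]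
    nlinarith
  linarith

/-! ### Topology of the complement of the divisor. -/

theorem isClosed_divisor : IsClosed (divisor n) :=
  isClosed_eq (proj₀ (n := n)).continuous continuous_const

/-- The divisor is a real subspace of codimension two. -/
theorem isPreconnected_compl_divisor : IsPreconnected ((divisor n)ᶜ) := by
  have hsurj : LinearMap.range (proj₀ (n := n)).toLinearMap = ⊤ := by
    rw [LinearMap.range_eq_top]
    intro c
    exact ⟨EuclideanSpace.single 0 c, by simp⟩
  have hrank : 1 < Module.rank ℝ (EuclideanSpace ℂ (Fin n) ⧸
      LinearMap.ker (proj₀ (n := n)).toLinearMap) := by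
    rw [((proj₀ (n := n)).toLinearMap.quotKerEquivOfSurjective
      (LinearMap.range_eq_top.1 hsurj)).rank_eq, Complex.rank_real_complex]
    exact Cardinal.one_lt_two
  exact (isConnected_compl_of_one_lt_codim hrank).isPreconnected

/-- The homeomorphism `univBall` from the whole space to the ball moves points along rays and `p ∈
D`, so it preserves membership in `D`; the punctured ball is the image of the complement of `D`. -/
theorem isPreconnected_ball_diff_divisor {p : E} (hp : p ∈ divisor n) {R : ℝ} (hR : 0 < R) :
    IsPreconnected (Metric.ball p R \ divisor n) := by
  have himg : OpenPartialHomeomorph.univBall p R '' (divisor n)ᶜ = Metric.ball p R \ divisor n := by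
    have hmem : ∀ x, OpenPartialHomeomorph.univBall p R x ∈ divisor n ↔ x ∈ divisor n := by
      intro x
      have hx : OpenPartialHomeomorph.univBall p R x
          = R • (√(1 + ‖x‖ ^ 2))⁻¹ • x + p := by
        rw [OpenPartialHomeomorph.univBall, dif_pos hR]
        rfl
      have h1 : (√(1 + ‖x‖ ^ 2))⁻¹ ≠ 0 := by positivity
      rw [hx, mem_divisor_iff, mem_divisor_iff, PiLp.add_apply, mem_divisor_iff.1 hp, add_zero,
        PiLp.smul_apply, PiLp.smul_apply, smul_eq_zero_iff_right hR.ne',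
        smul_eq_zero_iff_right h1]
    ext z
    constructor
    · rintro ⟨x, hx, rfl⟩
      refine ⟨?_, fun h => hx ((hmem x).1 h)⟩
      rw [← OpenPartialHomeomorph.univBall_target p hR]
      exact (OpenPartialHomeomorph.univBall p R).map_source (by simp)
    · rintro ⟨hz, hzD⟩
      rw [← OpenPartialHomeomorph.univBall_target p hR] at hz
      have h := (OpenPartialHomeomorph.univBall p R).right_inv hz
      exact ⟨_, fun hD => hzD (h ▸ (hmem _).2 hD), h⟩
  rw [← himg]
  exact isPreconnected_compl_divisor.image _
    (OpenPartialHomeomorph.continuous_univBall p R).continuousOn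

theorem nonempty_diff_divisor {U : Set E} (hU : IsOpen U) (hne : U.Nonempty) :
    (U \ divisor n).Nonempty := by
  obtain ⟨p, hp⟩ := hne
  by_cases hpD : p ∈ divisor n
  · have hc : Continuous fun t : ℝ => p + (t : ℂ) • (EuclideanSpace.single 0 1 : E) := by fun_prop
    have h0 : ∀ᶠ t : ℝ in nhds 0, p + (t : ℂ) • (EuclideanSpace.single 0 1 : E) ∈ U :=
      hc.continuousAt.eventually (hU.mem_nhds (by simpa using hp))
    obtain ⟨d, hd0, hd⟩ := Metric.eventually_nhds_iff_ball.1 h0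
    refine ⟨_, hd (d / 2) ?_, ?_⟩
    · rw [mem_ball_zero_iff, Real.norm_of_nonneg (by positivity)]
      linarith
    · rw [mem_divisor_iff, PiLp.add_apply, mem_divisor_iff.1 hpD]
      simp [hd0.ne']
  · exact ⟨p, hp, hpD⟩

end Conical

end

/-! ### The dichotomy and the connectedness argument. -/

theorem mainTheorem8 (n : ℕ) [NeZero n] (β : ℝ) (hβ₀ : 0 < β) (hβ₁ : β < 1)
    (Ω : Set (EuclideanSpace ℂ (Fin n))) (hΩ_open : IsOpen Ω) (hΩ_conn : IsConnected Ω)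
    (hΩ_bdd : Bornology.IsBounded Ω) (hΩ_D : (Ω ∩ Conical.divisor n).Nonempty)
    (g : EuclideanSpace ℂ (Fin n) → Matrix (Fin n) (Fin n) ℂ)
    (hg : Conical.IsWeakConicalMetric β g Ω)
    (u : EuclideanSpace ℂ (Fin n) → ℝ)
    (hu_C2 : ContDiffOn ℝ 2 u (Ω \ Conical.divisor n))
    (hu_bdd : ∃ M : ℝ, ∀ z ∈ Ω \ Conical.divisor n, |u z| ≤ M)
    (hu_sub : ∀ z ∈ Ω \ Conical.divisor n, 0 ≤ Conical.laplacian g u z)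
    (Ω' : Set (EuclideanSpace ℂ (Fin n))) (hΩ'_open : IsOpen Ω') (hΩ'_conn : IsConnected Ω')
    (hΩ'_cpt : IsCompact (closure Ω')) (hΩ'_sub : closure Ω' ⊆ Ω)
    (hsup : sSup (u '' (Ω \ Conical.divisor n)) = sSup (u '' (Ω' \ Conical.divisor n))) :
    ∃ c : ℝ, ∀ z ∈ Ω \ Conical.divisor n, u z = c := by
  obtain ⟨M, hM⟩ := hu_bdd
  obtain ⟨C, hC, hgC⟩ := hg.quasiIsometric
  have hgpos := hg.kahler.posDef
  have hgc : ContinuousOn g (Ω \ Conical.divisor n) :=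
    continuousOn_pi.2 fun j => continuousOn_pi.2 fun k => (hg.kahler.smooth j k).continuousOn
  have hUo : IsOpen (Ω \ Conical.divisor n) := hΩ_open.sdiff Conical.isClosed_divisor
  set c := sSup (u '' (Ω \ Conical.divisor n)) with hcdef
  have hle : ∀ z ∈ Ω \ Conical.divisor n, u z ≤ c := fun z hz =>
    le_csSup ⟨M, by rintro _ ⟨x, hx, rfl⟩; exact (abs_le.1 (hM x hx)).2⟩ ⟨z, hz, rfl⟩
  refine ⟨c, ?_⟩
  -- near each point of `Ω`, `u` either equals `c` or is smaller by a definite amount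
  have hdich : ∀ p ∈ Ω, (∀ᶠ z in nhds p, z ∉ Conical.divisor n → u z = c) ∨
      ∃ δ > 0, ∀ᶠ z in nhds p, z ∉ Conical.divisor n → u z ≤ c - δ := by
    intro p hp
    by_cases hpD : p ∈ Conical.divisor n
    · obtain ⟨R, hR, hRΩ⟩ := Metric.nhds_basis_closedBall.mem_iff.1 (hΩ_open.mem_nhds hp)
      have hb : Metric.ball p R \ Conical.divisor n ⊆ Ω \ Conical.divisor n := fun z hz =>
        ⟨hRΩ (Metric.ball_subset_closedBall hz.1), hz.2⟩
      by_cases hex : ∃ x ∈ Metric.ball p R \ Conical.divisor n, u x = c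
      · obtain ⟨x, hx, hux⟩ := hex
        have := Conical.eq_of_max (Metric.isOpen_ball.sdiff Conical.isClosed_divisor)
          (Conical.isPreconnected_ball_diff_divisor hpD hR) (hgc.mono hb)
          (fun z hz => hgpos z (hb hz)) (hu_C2.mono hb) (fun z hz => hu_sub z (hb hz))
          (fun z hz => hle z (hb hz)) hx hux
        left
        filter_upwards [Metric.ball_mem_nhds p hR] with z hz hzD using this z ⟨hz, hzD⟩
      · right
        push Not at hex
        -- Halving the radius puts the closed ball inside the open one, where `u < c` is known.
        have hRb : Metric.closedBall p (R / 2) ⊆ Metric.ball p R :=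
          Metric.closedBall_subset_ball (by linarith)
        exact Conical.eventually_le_sub_of_lt hβ₀ hβ₁ hC hΩ_open hgpos hgC hu_C2 hu_sub hpD
          (half_pos hR) ((hRb.trans Metric.ball_subset_closedBall).trans hRΩ) fun z hz =>
            lt_of_le_of_ne (hle z (hb ⟨hRb hz.1, hz.2⟩)) (hex z ⟨hRb hz.1, hz.2⟩)
    · by_cases hpc : u p = c
      · left
        filter_upwards [Conical.eventually_eq_of_max hUo hgc hgpos hu_C2 hu_sub hle
          ⟨hp, hpD⟩ hpc] with z hz _ using hz
      · right
        have hlt : u p < c := lt_of_le_of_ne (hle p ⟨hp, hpD⟩) hpc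
        refine ⟨(c - u p) / 2, by linarith, ?_⟩
        have hcont : ContinuousAt u p := hu_C2.continuousOn.continuousAt (hUo.mem_nhds ⟨hp, hpD⟩)
        filter_upwards [hcont.eventually (gt_mem_nhds (by linarith : u p < c - (c - u p) / 2))]
          with z hz _ using hz.le
  -- the first alternative occurs somewhere
  have hex : ∃ p ∈ Ω, ∀ᶠ z in nhds p, z ∉ Conical.divisor n → u z = c := by
    by_contra hno
    have hδ : ∃ δ > 0, ∀ z ∈ closure Ω', z ∉ Conical.divisor n → u z ≤ c - δ := by
      refine hΩ'_cpt.induction_on (p := fun s => ∃ δ > 0, ∀ z ∈ s, z ∉ Conical.divisor n →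
        u z ≤ c - δ) ⟨1, one_pos, by simp⟩ ?_ ?_ ?_
      · rintro s t hst ⟨δ, hδ, h⟩
        exact ⟨δ, hδ, fun z hz => h z (hst hz)⟩
      · rintro s t ⟨δ, hδ, h⟩ ⟨δ', hδ', h'⟩
        refine ⟨min δ δ', lt_min hδ hδ', fun z hz hzD => ?_⟩
        rcases hz with hz | hz
        · exact (h z hz hzD).trans (sub_le_sub_left (min_le_left _ _) _)
        · exact (h' z hz hzD).trans (sub_le_sub_left (min_le_right _ _) _)
      · intro x hx
        rcases hdich x (hΩ'_sub hx) with h | ⟨δ, hδ, h⟩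
        · exact (hno ⟨x, hΩ'_sub hx, h⟩).elim
        · exact ⟨_, mem_nhdsWithin_of_mem_nhds h, δ, hδ, fun z hz => hz⟩
    obtain ⟨δ, hδ, h⟩ := hδ
    -- Nonemptiness is needed for `csSup_le`, since `sSup ∅` is the default value `0`.
    have hne := Conical.nonempty_diff_divisor hΩ'_open hΩ'_conn.nonempty
    have : c ≤ c - δ := by
      conv_lhs => rw [hsup]
      refine csSup_le (hne.image u) ?_
      rintro _ ⟨z, hz, rfl⟩
      exact h z (subset_closure hz.1) hz.2
    linarith
  obtain ⟨p, hp, hpc⟩ := hex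
  have hA : IsOpen {x | ∀ᶠ z in nhds x, z ∉ Conical.divisor n → u z = c} :=
    isOpen_iff_mem_nhds.2 fun x hx => eventually_eventually_nhds.2 hx
  have hB : IsOpen {x | ∃ δ > 0, ∀ᶠ z in nhds x, z ∉ Conical.divisor n → u z ≤ c - δ} := by
    refine isOpen_iff_mem_nhds.2 fun x hx => ?_
    obtain ⟨δ, hδ, h⟩ := hx
    filter_upwards [eventually_eventually_nhds.2 h] with y hy using ⟨δ, hδ, hy⟩
  intro z hz
  rcases hdich z hz.1 with h | h
  · exact h.self_of_nhds hz.2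
  · obtain ⟨x, -, hxa, δ, hδ, hxb⟩ := hΩ_conn.isPreconnected _ _ hA hB hdich
      ⟨p, hp, hpc⟩ ⟨z, hz.1, h⟩
    -- Where both alternatives hold, a nearby point off `D` would satisfy `c ≤ c - δ`.
    obtain ⟨U, hU, hUo', hxU⟩ := mem_nhds_iff.1 (Filter.inter_mem hxa hxb)
    obtain ⟨y, hy, hyD⟩ := Conical.nonempty_diff_divisor hUo' ⟨x, hxU⟩
    have h1 := (hU hy).1 hyD
    have h2 := (hU hy).2 hyD
    linarith
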